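/- Let $d\ge 1$, $1\le t\le d$, $R\ge 2$ and $n_1,\dots,n_d$ be natural numbers, and let $U_j=[\mathbf u_{j,1},\dots,\mathbf u_{j,R}]\in\mathbb R^{n_j\times R}$ $(1\le j\le d)$ and $\sigma\in\mathbb R^R$. Put $$\mathcal A=\llbracket\sigma;U_1,\dots,U_d\rrbracket:=\sum_{i=1}^R\sigma_i\,\mathbf u_{1,i}\otimes\cdots\otimes\mathbf u_{d,i}\in\mathbb R^{n_1\times\cdots\times n_d}.$$ Assume that $\sigma_i\ne0$ and $\mathbf u_{j,i}\neq 0$ for all $i,j$, and that the last $t$ factors are columnwise orthonormal, i.e. $U_j^\top U_j=I$ for $d-t+1\le j\le d$. Let $k_U$ denote the Kruskal rank of a matrix $U$: the maximum $k$, not exceeding the number of columns, such that any $k$ columns of $U$ are linearly independent. Suppose that one of the following holds: 1. $t=1$ and $\sum_{j=1}^{d-1}k_{U_j}\ge R+d-1$; 2. $t=2$ and there is $\bar j\le d-t$ with $k_{U_{\bar j}}\ge2$; 3. $3\le t\le d$. Then the decomposition is unique, in the following sense. (a) Whenever $\mathcal A=\sum_{i=1}^R\tau_i\,\mathbf v_{1,i}\otimes\cdots\otimes\mathbf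 v_{d,i}$ with arbitrary $\tau_i\in\mathbb R$ and $\mathbf v_{j,i}\in\mathbb R^{n_j}$, there is a permutation $\pi$ of $\{1,\dots,R\}$ such that for all $i$ $$\tau_i\,\mathbf v_{1,i}\otimes\cdots\otimes\mathbf v_{d,i}=\sigma_{\pi(i)}\,\mathbf u_{1,\pi(i)}\otimes\cdots\otimes\mathbf u_{d,\pi(i)},$$ and each $\mathbf v_{j,i}$ is a nonzero multiple of $\mathbf u_{j,\pi(i)}$. (b) If moreover the columns of $U_1,\dots,U_{d-t}$ are unit vectors, then $(\sigma,U_1,\dots,U_d)$ is a global minimizer of the problem $$\min_{\tau,V}\ \tfrac12\bigl\|\mathcal A-\llbracket\tau;V_1,\dots,V_d\rrbracket\bigr\|_F^2\quad\text{s.t. } \mathbf v_{j,i}^\top\mathbf v_{j,i}=1\ (1\le j\le d-t,\ 1\le i\le R),\quad V_j^\top V_j=I\ (d-t+1\le j\le d),$$ where $\tau\in\mathbb R^R$ and $V_j=[\mathbf v_{j,1},\dots,\mathbf v_{j,R}]\in\mathbb R^{n_j\times R}$, and it is the only one up to permutation and signs: for every global minimizer $(\tau,V_1,\dots,V_d)$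 there are a permutation $\pi$ and signs $\varepsilon_{j,i}\in\{1,-1\}$ with $\mathbf v_{j,i}=\varepsilon_{j,i}\mathbf u_{j,\pi(i)}$ and $\tau_i=\bigl(\prod_{j=1}^d\varepsilon_{j,i}\bigr)\sigma_{\pi(i)}$ for all $i,j$. -/

import Mathlib

open scoped BigOperators Matrix

noncomputable section

namespace OrthCPD

/-- The Kruskal rank of a real matrix: the largest `k` (at most the number of columns) such that
any `k` columns are linearly independent. -/
def kruskalRank {m R : ℕ} (U : Matrix (Fin m) (Fin R) ℝ) : ℕ :=
  sSup {k : ℕ | k ≤ R ∧ ∀ s : Finset (Fin R), s.card = k → LinearIndepOn ℝ U.col (s : Set (Fin R))}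

theorem kruskalRank_isGreatest {m R : ℕ} (U : Matrix (Fin m) (Fin R) ℝ) :
    IsGreatest {k : ℕ | k ≤ R ∧ ∀ s : Finset (Fin R), s.card = k →
      LinearIndepOn ℝ U.col (s : Set (Fin R))} (kruskalRank U) := by
  have hb : BddAbove {k : ℕ | k ≤ R ∧ ∀ s : Finset (Fin R), s.card = k →
      LinearIndepOn ℝ U.col (s : Set (Fin R))} := ⟨R, fun k hk => hk.1⟩
  refine ⟨Nat.sSup_mem ⟨0, Nat.zero_le _, fun s hs => ?_⟩ hb, fun k hk => le_csSup hb hk⟩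
  rw [Finset.card_eq_zero] at hs
  subst hs
  simp

/-- Real tensors of order `d` and size `n 0 × ⋯ × n (d - 1)`, as multiway arrays. -/
abbrev Tensor {d : ℕ} (n : Fin d → ℕ) : Type := ((j : Fin d) → Fin (n j)) → ℝ

/-- A tuple of factor matrices `U j ∈ ℝ^{n j × R}`; column `i` of `U j` is the vector `u_{j,i}`. -/
abbrev Factors {d : ℕ} (n : Fin d → ℕ) (R : ℕ) : Type :=
  (j : Fin d) → Matrix (Fin (n j)) (Fin R) ℝ

/-- The outer product `u_{1,i} ⊗ ⋯ ⊗ u_{d,i}` of the `i`-th columns of the factors. -/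
def outer {d R : ℕ} {n : Fin d → ℕ} (U : Factors n R) (i : Fin R) : Tensor n :=
  fun a => ∏ j, U j (a j) i

/-- `⟦σ; U_1, …, U_d⟧ = ∑ i, σ_i u_{1,i} ⊗ ⋯ ⊗ u_{d,i}`. -/
def cpd {d R : ℕ} {n : Fin d → ℕ} (σ : Fin R → ℝ) (U : Factors n R) : Tensor n :=
  ∑ i, σ i • outer U i

/-- Half the squared Frobenius distance between `A` and `⟦σ; U_1, …, U_d⟧`. -/
def objective {d R : ℕ} {n : Fin d → ℕ} (A : Tensor n) (σ : Fin R → ℝ) (U : Factors n R) : ℝ :=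
  (1 / 2) * ∑ a, (A a - cpd σ U a) ^ 2

/-- The last `t` of the `d` factors are columnwise orthonormal. -/
def LastOrthonormal {d R : ℕ} {n : Fin d → ℕ} (t : ℕ) (U : Factors n R) : Prop :=
  ∀ j : Fin d, d ≤ (j : ℕ) + t → (U j)ᵀ * U j = 1

/-- The constraints of the optimization problem: the first `d - t` factors have unit columns, the
last `t` factors are columnwise orthonormal. -/
def Feasible {d R : ℕ} {n : Fin d → ℕ} (t : ℕ) (U : Factors n R) : Prop :=
  (∀ j : Fin d, (j : ℕ) + t < d → ∀ i, (U j).col i ⬝ᵥ (U j).col i = 1) ∧ LastOrthonormal t U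

/-- `(σ, U)` is a solution (global minimizer) of: minimize `objective A` subject to `Feasible t`. -/
def IsSolution {d R : ℕ} {n : Fin d → ℕ} (t : ℕ) (A : Tensor n) (σ : Fin R → ℝ)
    (U : Factors n R) : Prop :=
  Feasible t U ∧
    ∀ (τ : Fin R → ℝ) (V : Factors n R), Feasible t V → objective A σ U ≤ objective A τ V

/-- The decomposition `⟦σ; U_1, …, U_d⟧` is unique: whenever the same tensor is written as a
combination of `R` outer products (of arbitrary vectors, with arbitrary real coefficients), the
terms are the same up to one permutation, and the vectors in them agree up to nonzero scalars. -/
def IsUniqueDecomposition {d R : ℕ} {n : Fin d → ℕ} (σ : Fin R → ℝ) (U : Factors n R) : Prop :=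
  ∀ (τ : Fin R → ℝ) (V : Factors n R), cpd τ V = cpd σ U →
    ∃ π : Equiv.Perm (Fin R),
      (∀ i, τ i • outer V i = σ (π i) • outer U (π i)) ∧
      ∀ j i, ∃ c : ℝ, c ≠ 0 ∧ (V j).col i = c • (U j).col (π i)

/-- `(σ, U)` is a solution of the constrained problem and it is the only one, except for a
permutation of the terms and for signs `ε j i = ± 1` of the vectors, compensated in the
coefficient. -/
def IsUniqueSolution {d R : ℕ} {n : Fin d → ℕ} (t : ℕ) (A : Tensor n) (σ : Fin R → ℝ)
    (U : Factors n R) : Prop :=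
  IsSolution t A σ U ∧
    ∀ (τ : Fin R → ℝ) (V : Factors n R), IsSolution t A τ V →
      ∃ (π : Equiv.Perm (Fin R)) (ε : Fin d → Fin R → ℝ),
        (∀ j i, ε j i = 1 ∨ ε j i = -1) ∧
        (∀ j i, (V j).col i = ε j i • (U j).col (π i)) ∧
        ∀ i, τ i = (∏ j, ε j i) * σ (π i)

end OrthCPD

end

/-!
The last factor is columnwise orthonormal, and each of the three hypotheses yields the single
inequality `R ≤ ∑ (k_j - 1)`, the sum running over all modes but the last. When one factor has
linearly independent columns this is Kruskal's condition for order-`d` tensors, and uniqueness then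
has a proof that avoids Kruskal's permutation lemma.

Write `B_i` for the outer product of the `i`-th columns of all factors but the last, here encoded as
the multilinear form `rankOneForm`, and let `c_i` be the `i`-th column of the last factor. A mode of
Kruskal rank `k` has, for any `k - 1` columns and any further column, a functional vanishing on the
former and not on the latter. Using the modes together, one annihilates all the `B_l` in any set of
size at most `∑ (k_j - 1)` while keeping one more (`exists_rankOneForm_ne_zero`). Hence the `B_i` are
linearly independent (`linearIndependent_rankOneForm`), and a combination of them that is itself an
outer product has only one nonzero coefficient (`eq_zero_or_eq_zero_of_sum_eq_rankOneForm`).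

Given another decomposition, with forms `B'_i` and last columns `c'_i`, contracting the last mode
with `c_l` shows that `B_l` lies in the span of the `B'_i`. By dimension the two spans agree and the
`B'_i` are linearly independent, so `B'_i` is a nonzero multiple of `B_{π i}` for some permutation
`π`. Comparing the coefficients of the `B_l` makes `c'_i` a multiple of `c_{π i}`
(`isUniqueDecomposition_of_orthonormal`).

For the optimization problem, the given feasible decomposition has objective zero, so every solution
is an exact decomposition. Uniqueness applies to it, and nonzero scalars between unit vectors are
signs (`IsUniqueDecomposition.isUniqueSolution`).
-/

namespace OrthCPD

/-! ### Kruskal rank -/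

/-- The columns in any set of at most `kruskalRank U` indices are linearly independent. -/
theorem linearIndepOn_of_card_le_kruskalRank {m R : ℕ} (U : Matrix (Fin m) (Fin R) ℝ)
    (s : Finset (Fin R)) (hs : s.card ≤ kruskalRank U) :
    LinearIndepOn ℝ U.col (s : Set (Fin R)) := by
  obtain ⟨hk, hind⟩ := (kruskalRank_isGreatest U).1
  obtain ⟨s', hss', -, hs'⟩ :=
    Finset.exists_subsuperset_card_eq (Finset.subset_univ s) hs (by simpa using hk)
  exact (hind s' hs').mono (by exact_mod_cast hss')

theorem kruskalRank_le {m R : ℕ} (U : Matrix (Fin m) (Fin R) ℝ) : kruskalRank U ≤ R :=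
  (kruskalRank_isGreatest U).1.1

theorem one_le_kruskalRank {m R : ℕ} (U : Matrix (Fin m) (Fin R) ℝ) (hR : 1 ≤ R)
    (hU : ∀ i, U.col i ≠ 0) : 1 ≤ kruskalRank U := by
  refine (kruskalRank_isGreatest U).2 ⟨hR, fun s hs => ?_⟩
  obtain ⟨i, rfl⟩ := Finset.card_eq_one.1 hs
  simpa using hU i

theorem col_dotProduct_col_of_orthonormal {m R : ℕ} {U : Matrix (Fin m) (Fin R) ℝ}
    (hU : Uᵀ * U = 1) (i l : Fin R) : U.col i ⬝ᵥ U.col l = if i = l then 1 else 0 := by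
  have := congrFun (congrFun hU i) l
  rw [Matrix.one_apply] at this
  exact this

theorem kruskalRank_eq_of_orthonormal {m R : ℕ} {U : Matrix (Fin m) (Fin R) ℝ}
    (hU : Uᵀ * U = 1) : kruskalRank U = R := by
  refine le_antisymm (kruskalRank_le U) ((kruskalRank_isGreatest U).2 ⟨le_rfl, fun s _ => ?_⟩)
  have h : LinearIndependent ℝ U.col := by
    rw [Fintype.linearIndependent_iff]
    intro g hg i
    have := congrArg (fun v => U.col i ⬝ᵥ v) hg
    simpa [dotProduct_sum, dotProduct_smul, col_dotProduct_col_of_orthonormal hU] using this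
  exact h.linearIndepOn s

/-- A single mode can annihilate `kruskalRank U - 1` columns while keeping another one. -/
theorem exists_dotProduct_ne_zero_of_card_lt {m R : ℕ} (U : Matrix (Fin m) (Fin R) ℝ)
    (L : Finset (Fin R)) (l₀ : Fin R) (hl₀ : l₀ ∉ L) (hL : L.card + 1 ≤ kruskalRank U) :
    ∃ x : Fin m → ℝ, x ⬝ᵥ U.col l₀ ≠ 0 ∧ ∀ l ∈ L, x ⬝ᵥ U.col l = 0 := by
  have hind := linearIndepOn_of_card_le_kruskalRank U (insert l₀ L)
    (by rw [Finset.card_insert_of_notMem hl₀]; exact hL)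
  rw [Finset.coe_insert, linearIndepOn_insert (by simpa using hl₀)] at hind
  obtain ⟨f, hf, hker⟩ := Submodule.exists_le_ker_of_notMem hind.2
  have key : ∀ v : Fin m → ℝ, (fun a => f (Pi.single a 1)) ⬝ᵥ v = f v := by
    intro v
    rw [LinearMap.pi_apply_eq_sum_univ f v, dotProduct]
    refine Finset.sum_congr rfl fun a _ => ?_
    rw [smul_eq_mul, mul_comm]
    congr 2
    ext b
    simp [Pi.single_apply, eq_comm]
  refine ⟨fun a => f (Pi.single a 1), by rwa [key], fun l hl => ?_⟩
  rw [key]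
  exact hker (Submodule.subset_span ⟨l, by simpa using hl, rfl⟩)

/-! ### Partial outer products as multilinear forms -/

variable {d R : ℕ} {n : Fin d → ℕ}

/-- The rank-one multilinear form `x ↦ ∏_{j ∈ J} ⟨x_j, u_{j,i}⟩` given by the `i`-th columns of the
factors with index in `J`. It represents the partial outer product `⨂_{j ∈ J} u_{j,i}`, but its
domain consists of full tuples `x`, so that no tensors of lower order are needed. -/
def rankOneForm (J : Finset (Fin d)) (U : Factors n R) (i : Fin R) :
    ((j : Fin d) → Fin (n j) → ℝ) → ℝ :=
  fun x => ∏ j ∈ J, x j ⬝ᵥ (U j).col i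

theorem rankOneForm_update_of_notMem {J : Finset (Fin d)} {j : Fin d} (hj : j ∉ J)
    (U : Factors n R) (i : Fin R) (x : (j : Fin d) → Fin (n j) → ℝ) (y : Fin (n j) → ℝ) :
    rankOneForm J U i (Function.update x j y) = rankOneForm J U i x := by
  refine Finset.prod_congr rfl fun k hk => ?_
  rw [Function.update_of_ne (ne_of_mem_of_not_mem hk hj)]

theorem rankOneForm_update_of_mem {J : Finset (Fin d)} {j : Fin d} (hj : j ∈ J)
    (U : Factors n R) (i : Fin R) (x : (j : Fin d) → Fin (n j) → ℝ) (y : Fin (n j) → ℝ) :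
    rankOneForm J U i (Function.update x j y) =
      (y ⬝ᵥ (U j).col i) * rankOneForm (J.erase j) U i x := by
  rw [← rankOneForm_update_of_notMem (Finset.notMem_erase j J) U i x y]
  simp only [rankOneForm]
  rw [← Finset.mul_prod_erase J _ hj, Function.update_self]

theorem rankOneForm_single (J : Finset (Fin d)) (U : Factors n R) (i : Fin R)
    (a : (j : Fin d) → Fin (n j)) :
    rankOneForm J U i (fun j => Pi.single (a j) 1) = ∏ j ∈ J, U j (a j) i := by
  simp [rankOneForm]

/-- Contracting a tensor `⟦σ; U⟧` with `x_1 ⊗ ⋯ ⊗ x_d`. -/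
theorem sum_cpd_mul_prod (σ : Fin R → ℝ) (U : Factors n R)
    (x : (j : Fin d) → Fin (n j) → ℝ) :
    ∑ a, cpd σ U a * ∏ j, x j (a j) = ∑ i, σ i * rankOneForm Finset.univ U i x := by
  simp only [cpd, Finset.sum_apply, Pi.smul_apply, smul_eq_mul, outer, Finset.sum_mul]
  rw [Finset.sum_comm]
  refine Finset.sum_congr rfl fun i _ => ?_
  simp only [rankOneForm, dotProduct, Finset.prod_univ_sum, Fintype.piFinset_univ,
    Finset.mul_sum, Finset.prod_mul_distrib, Matrix.col_apply]
  exact Finset.sum_congr rfl fun a _ => by ring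

/-! ### Spans of partial outer products -/

/-- The modes in `J` together can annihilate `∑_{j ∈ J} (k_j - 1)` of the rank-one terms while
keeping another one: mode `j` takes care of `k_j - 1` of them. -/
theorem exists_rankOneForm_ne_zero (U : Factors n R) (hk : ∀ j, 1 ≤ kruskalRank (U j))
    (J : Finset (Fin d)) (l₀ : Fin R) (L : Finset (Fin R)) (hl₀ : l₀ ∉ L)
    (hL : L.card ≤ ∑ j ∈ J, (kruskalRank (U j) - 1)) :
    ∃ x, rankOneForm J U l₀ x ≠ 0 ∧ ∀ l ∈ L, rankOneForm J U l x = 0 := by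
  induction J using Finset.induction_on generalizing L with
  | empty =>
    have : L = ∅ := by simpa using hL
    subst this
    exact ⟨fun _ => 0, by simp [rankOneForm], by simp⟩
  | insert j J hj ih =>
    rw [Finset.sum_insert hj] at hL
    obtain ⟨L₁, hL₁, hcard⟩ := Finset.exists_subset_card_eq
      (min_le_left L.card (kruskalRank (U j) - 1))
    have hdiff := Finset.card_sdiff_add_card_eq_card hL₁
    have hk' := hk j
    obtain ⟨x, hx₀, hx⟩ := ih (L \ L₁) (by simp [hl₀]) (by omega)
    obtain ⟨y, hy₀, hy⟩ := exists_dotProduct_ne_zero_of_card_lt (U j) L₁ l₀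
      (fun h => hl₀ (hL₁ h)) (by omega)
    refine ⟨Function.update x j y, ?_, fun l hl => ?_⟩ <;>
      rw [rankOneForm_update_of_mem (Finset.mem_insert_self j J), Finset.erase_insert hj]
    · exact mul_ne_zero hy₀ hx₀
    · by_cases h : l ∈ L₁
      · rw [hy l h, zero_mul]
      · rw [hx l (by simp [hl, h]), mul_zero]

/-- The partial outer products are linearly independent. -/
theorem linearIndependent_rankOneForm (U : Factors n R) (hk : ∀ j, 1 ≤ kruskalRank (U j))
    (J : Finset (Fin d)) (hJ : R ≤ ∑ j ∈ J, (kruskalRank (U j) - 1) + 1) :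
    LinearIndependent ℝ (rankOneForm J U) := by
  rw [Fintype.linearIndependent_iff]
  intro g hg i
  obtain ⟨x, hx₀, hx⟩ := exists_rankOneForm_ne_zero U hk J i (Finset.univ.erase i) (by simp)
    (by rw [Finset.card_erase_of_mem (Finset.mem_univ i), Finset.card_fin]; omega)
  have := congrFun hg x
  rw [Finset.sum_apply, Finset.sum_eq_single i (fun l _ hl => by simp [hx l (by simp [hl])])
    (by simp)] at this
  simpa [hx₀] using this

/-- A combination of the partial outer products in which two coefficients are nonzero is not an
outer product. Contracting all modes but a suitable `j` in two ways produces two vectors parallel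
to the same `w_j`, of which the first involves `u_{j,l₀}` but not `u_{j,l₁}` and the second
`u_{j,l₁}` but not `u_{j,l₀}`, together with the same `k_j - 2` further columns. -/
theorem eq_zero_or_eq_zero_of_sum_eq_rankOneForm {R' : ℕ} (U : Factors n R)
    (hk : ∀ j, 1 ≤ kruskalRank (U j)) (J : Finset (Fin d))
    (hJ : R ≤ ∑ j ∈ J, (kruskalRank (U j) - 1)) (V : Factors n R') (i : Fin R')
    (α : Fin R → ℝ) (h : ∑ l, α l • rankOneForm J U l = rankOneForm J V i)
    (l₀ l₁ : Fin R) (hl : l₀ ≠ l₁) : α l₀ = 0 ∨ α l₁ = 0 := by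
  by_contra! hα
  obtain ⟨hα₀, hα₁⟩ := hα
  have hR : 0 < R := l₀.pos
  obtain ⟨j, hjJ, hj⟩ : ∃ j ∈ J, kruskalRank (U j) - 1 ≠ 0 := by
    by_contra! h0
    rw [Finset.sum_eq_zero h0] at hJ
    omega
  have hkR := kruskalRank_le (U j)
  rw [← Finset.add_sum_erase J _ hjJ] at hJ
  have hpair : ({l₀, l₁} : Finset (Fin R)).card = 2 := Finset.card_pair hl
  obtain ⟨S, hS, -, hScard⟩ := Finset.exists_subsuperset_card_eq
    (n := kruskalRank (U j)) (Finset.subset_univ ({l₀, l₁} : Finset (Fin R)))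
    (by omega) (by simpa using hkR)
  have hmem₀ : l₀ ∈ S := hS (by simp)
  have hmem₁ : l₁ ∈ S := hS (by simp)
  have hind := linearIndepOn_of_card_le_kruskalRank (U j) S hScard.le
  -- Linear independence on `S`, for coefficients that vanish outside `S`.
  have hcoef : ∀ g : Fin R → ℝ, (∀ l ∉ S, g l = 0) → ∑ l, g l • (U j).col l = 0 →
      ∀ l, g l = 0 := by
    intro g hg hsum l
    by_cases hlS : l ∈ S
    · refine linearIndepOn_finset_iff.1 hind g ?_ l hlS
      rw [← hsum]
      exact Finset.sum_subset (Finset.subset_univ S) fun l _ hl => by simp [hg l hl]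
    · exact hg l hlS
  -- Contraction that keeps `p` and annihilates `q` and everything outside `S`.
  have hcontr : ∀ p q : Fin R, p ∈ S → q ∈ S → p ≠ q →
      ∃ (β : Fin R → ℝ) (γ : ℝ), β p ≠ 0 ∧ β q = 0 ∧ (∀ l ∉ S, β l = 0) ∧
        ∑ l, (α l * β l) • (U j).col l = γ • (V j).col i := by
    intro p q hp hq hpq
    obtain ⟨x, hx₀, hx⟩ := exists_rankOneForm_ne_zero U hk (J.erase j) p (insert q Sᶜ)
      (by simp [hpq, hp]) (by
        rw [Finset.card_insert_of_notMem (by simpa using hq), Finset.card_compl, hScard,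
          Fintype.card_fin]
        omega)
    refine ⟨fun l => rankOneForm (J.erase j) U l x, rankOneForm (J.erase j) V i x, hx₀,
      hx q (by simp), fun l hl => hx l (by simp [hl]), ?_⟩
    refine dotProduct_eq _ _ fun y => ?_
    have := congrFun h (Function.update x j y)
    simp only [Finset.sum_apply, Pi.smul_apply, smul_eq_mul, rankOneForm_update_of_mem hjJ]
      at this
    rw [sum_dotProduct, smul_dotProduct, smul_eq_mul, dotProduct_comm _ y, mul_comm, ← this]
    refine Finset.sum_congr rfl fun l _ => ?_
    rw [smul_dotProduct, smul_eq_mul, dotProduct_comm _ y]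
    ring
  obtain ⟨β₀, γ₀, h₀p, h₀q, h₀S, h₀⟩ := hcontr l₀ l₁ hmem₀ hmem₁ hl
  obtain ⟨β₁, γ₁, h₁p, h₁q, h₁S, h₁⟩ := hcontr l₁ l₀ hmem₁ hmem₀ hl.symm
  have hγ₁ : γ₁ ≠ 0 := by
    rintro rfl
    rw [zero_smul] at h₁
    exact mul_ne_zero hα₁ h₁p (hcoef _ (fun l hl => by simp [h₁S l hl]) h₁ l₁)
  have hrel := hcoef (fun l => γ₁ * (α l * β₀ l) - γ₀ * (α l * β₁ l))
    (fun l hl => by simp [h₀S l hl, h₁S l hl]) (by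
      simp only [sub_smul, Finset.sum_sub_distrib, mul_smul γ₁, mul_smul γ₀]
      rw [← Finset.smul_sum, ← Finset.smul_sum, h₀, h₁, smul_comm, sub_self]) l₀
  simp [h₁q, hγ₁, hα₀, h₀p] at hrel

/-- An outer product in the span of the partial outer products is a multiple of one of them. -/
theorem exists_eq_smul_of_mem_span {R' : ℕ} (U : Factors n R)
    (hk : ∀ j, 1 ≤ kruskalRank (U j)) (J : Finset (Fin d))
    (hJ : R ≤ ∑ j ∈ J, (kruskalRank (U j) - 1)) (V : Factors n R') (i : Fin R')
    (h : rankOneForm J V i ∈ Submodule.span ℝ (Set.range (rankOneForm J U)))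
    (h0 : rankOneForm J V i ≠ 0) :
    ∃ (l : Fin R) (c : ℝ), c ≠ 0 ∧ rankOneForm J V i = c • rankOneForm J U l := by
  obtain ⟨α, hα⟩ := (Submodule.mem_span_range_iff_exists_fun ℝ).1 h
  obtain ⟨l, hl⟩ : ∃ l, α l ≠ 0 := by
    by_contra! hz
    exact h0 (by rw [← hα]; simp [hz])
  refine ⟨l, α l, hl, ?_⟩
  rw [← hα]
  refine Finset.sum_eq_single l (fun l' _ hl' => ?_) (by simp)
  have := eq_zero_or_eq_zero_of_sum_eq_rankOneForm U hk J hJ V i α hα l l' hl'.symm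
  rw [this.resolve_left hl, zero_smul]

/-- Parallel outer products have parallel factors. -/
theorem exists_col_eq_smul_of_rankOneForm_eq_smul {R' : ℕ} {J : Finset (Fin d)}
    {U : Factors n R} {V : Factors n R'} {i : Fin R'} {l : Fin R} {c : ℝ}
    (h : rankOneForm J V i = c • rankOneForm J U l) (h0 : rankOneForm J V i ≠ 0)
    {j : Fin d} (hj : j ∈ J) : ∃ b : ℝ, b ≠ 0 ∧ (V j).col i = b • (U j).col l := by
  obtain ⟨x, hx⟩ := Function.ne_iff.1 h0
  have hx' : rankOneForm J V i x = c * rankOneForm J U l x := congrFun h x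
  have hU : rankOneForm J U l x ≠ 0 := fun hz => hx (by rw [hx', hz]; simp)
  have hc : c ≠ 0 := fun hz => hx (by rw [hx', hz]; simp)
  rw [← Function.update_eq_self j x, rankOneForm_update_of_mem hj] at hx hU
  have hVx : rankOneForm (J.erase j) V i x ≠ 0 := right_ne_zero_of_mul hx
  have hUx := right_ne_zero_of_mul hU
  refine ⟨(rankOneForm (J.erase j) V i x)⁻¹ * (c * rankOneForm (J.erase j) U l x),
    mul_ne_zero (inv_ne_zero hVx) (mul_ne_zero hc hUx), dotProduct_eq _ _ fun y => ?_⟩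
  have := congrFun h (Function.update x j y)
  simp only [Pi.smul_apply, smul_eq_mul, rankOneForm_update_of_mem hj] at this
  rw [smul_dotProduct, smul_eq_mul, dotProduct_comm, dotProduct_comm _ y]
  field_simp
  linear_combination this

/-! ### Uniqueness of the decomposition -/

/-- Two decompositions of one tensor, with mode `m` separated from the other modes. -/
theorem sum_smul_rankOneForm_erase_eq {R' : ℕ} {σ : Fin R → ℝ} {U : Factors n R}
    {τ : Fin R' → ℝ} {V : Factors n R'} (h : cpd τ V = cpd σ U) (m : Fin d)
    (y : Fin (n m) → ℝ) :
    ∑ i, (τ i * (y ⬝ᵥ (V m).col i)) • rankOneForm (Finset.univ.erase m) V i =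
      ∑ i, (σ i * (y ⬝ᵥ (U m).col i)) • rankOneForm (Finset.univ.erase m) U i := by
  ext x
  have hV := sum_cpd_mul_prod τ V (Function.update x m y)
  rw [h, sum_cpd_mul_prod] at hV
  simpa only [Finset.sum_apply, Pi.smul_apply, smul_eq_mul, mul_assoc,
    rankOneForm_update_of_mem (Finset.mem_univ m)] using hV.symm

/-- Uniqueness of the decomposition when one factor `U m` is columnwise orthonormal and the Kruskal
ranks of the others are large enough. -/
theorem isUniqueDecomposition_of_orthonormal {σ : Fin R → ℝ} {U : Factors n R} (m : Fin d)
    (hσ : ∀ i, σ i ≠ 0) (hU : ∀ j i, (U j).col i ≠ 0) (horth : (U m)ᵀ * U m = 1)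
    (hJ : R ≤ ∑ j ∈ Finset.univ.erase m, (kruskalRank (U j) - 1)) :
    IsUniqueDecomposition σ U := by
  intro τ V hVU
  rcases Nat.eq_zero_or_pos R with rfl | hR
  · exact ⟨1, fun i => i.elim0, fun _ i => i.elim0⟩
  have hk : ∀ j, 1 ≤ kruskalRank (U j) := fun j => one_le_kruskalRank (U j) hR (hU j)
  set J := Finset.univ.erase m with hJdef
  have hsep := sum_smul_rankOneForm_erase_eq hVU m
  rw [← hJdef] at hsep
  have hindU : LinearIndependent ℝ (rankOneForm J U) :=
    linearIndependent_rankOneForm U hk J (by omega)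
  -- Contracting mode `m` with the `l`-th column of `U m` isolates the `l`-th term.
  have hle : Submodule.span ℝ (Set.range (rankOneForm J U)) ≤
      Submodule.span ℝ (Set.range (rankOneForm J V)) := by
    rw [Submodule.span_le]
    rintro _ ⟨l, rfl⟩
    have h := hsep ((U m).col l)
    rw [Finset.sum_eq_single (f := fun i => (σ i * _) • rankOneForm J U i) l (fun i _ hi => by
      simp [col_dotProduct_col_of_orthonormal horth, hi.symm]) (by simp)] at h
    rw [col_dotProduct_col_of_orthonormal horth, if_pos rfl, mul_one] at h
    rw [SetLike.mem_coe, ← Submodule.smul_mem_iff _ (hσ l), ← h]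
    exact Submodule.sum_mem _ fun i _ =>
      Submodule.smul_mem _ _ (Submodule.subset_span ⟨i, rfl⟩)
  have hfinU := finrank_span_eq_card hindU
  have hfinV : Module.finrank ℝ (Submodule.span ℝ (Set.range (rankOneForm J V))) ≤
      Fintype.card (Fin R) := finrank_range_le_card (R := ℝ) (rankOneForm J V)
  have : FiniteDimensional ℝ (Submodule.span ℝ (Set.range (rankOneForm J V))) :=
    FiniteDimensional.span_of_finite ℝ (Set.finite_range _)
  have hspan := Submodule.eq_of_le_of_finrank_le hle (hfinV.trans hfinU.ge)
  have hindV : LinearIndependent ℝ (rankOneForm J V) := by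
    rw [linearIndependent_iff_card_eq_finrank_span, Set.finrank, ← hspan, hfinU]
  have hV0 := fun i => hindV.ne_zero i
  choose π lam hlam hπ using fun i => exists_eq_smul_of_mem_span U hk J hJ V i
    (hspan ▸ Submodule.subset_span ⟨i, rfl⟩) (hV0 i)
  have hinj : Function.Injective π := by
    intro i i' hii
    by_contra hne
    have := Fintype.linearIndependent_iff.1 hindV
      (Pi.single i (lam i') - Pi.single i' (lam i)) (by
        simp [sub_smul, Pi.single_apply, ite_smul, hπ i, hπ i', hii, smul_smul, mul_comm]) i
    simp [hne, hlam] at this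
  let ρ : Equiv.Perm (Fin R) := Equiv.ofBijective π (Finite.injective_iff_bijective.1 hinj)
  have hρ : ∀ i, rankOneForm J V i = lam i • rankOneForm J U (ρ i) := hπ
  have hlast : ∀ i, (τ i * lam i) • (V m).col i = σ (ρ i) • (U m).col (ρ i) := by
    intro i
    refine dotProduct_eq _ _ fun y => ?_
    have h := hsep y
    rw [← Equiv.sum_comp ρ (fun i => (σ i * _) • rankOneForm J U i)] at h
    simp only [hρ, smul_smul] at h
    have := Fintype.linearIndependent_iff.1 (hindU.comp ρ ρ.injective)
      (fun i => τ i * (y ⬝ᵥ (V m).col i) * lam i - σ (ρ i) * (y ⬝ᵥ (U m).col (ρ i)))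
      (by simpa [sub_smul, sub_eq_zero] using h) i
    rw [smul_dotProduct, smul_dotProduct, dotProduct_comm, dotProduct_comm _ y, smul_eq_mul,
      smul_eq_mul]
    linear_combination this
  refine ⟨ρ, fun i => ?_, fun j i => ?_⟩
  · ext a
    have h₁ := congrFun (hρ i) (fun j => Pi.single (a j) 1)
    have h₂ := congrFun (hlast i) (a m)
    rw [Pi.smul_apply, rankOneForm_single, rankOneForm_single] at h₁
    simp only [Pi.smul_apply, smul_eq_mul, Matrix.col_apply] at h₁ h₂
    simp only [Pi.smul_apply, smul_eq_mul, outer,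
      ← Finset.mul_prod_erase Finset.univ _ (Finset.mem_univ m), ← hJdef, h₁]
    linear_combination (∏ j ∈ J, U j (a j) (ρ i)) * h₂
  · by_cases hj : j = m
    · subst hj
      have hne : τ i * lam i ≠ 0 := fun hz => by
        have := hlast i
        rw [hz, zero_smul] at this
        exact smul_ne_zero (hσ _) (hU j _) this.symm
      refine ⟨(τ i * lam i)⁻¹ * σ (ρ i), mul_ne_zero (inv_ne_zero hne) (hσ _), ?_⟩
      rw [mul_smul, ← hlast, inv_smul_smul₀ hne]
    · exact exists_col_eq_smul_of_rankOneForm_eq_smul (hρ i) (hV0 i) (by simp [J, hj])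

/-! ### Uniqueness of the solution of the optimization problem -/

theorem objective_nonneg (A : Tensor n) (σ : Fin R → ℝ) (U : Factors n R) :
    0 ≤ objective A σ U := by
  unfold objective
  positivity

theorem objective_eq_zero_iff {A : Tensor n} {σ : Fin R → ℝ} {U : Factors n R} :
    objective A σ U = 0 ↔ cpd σ U = A := by
  rw [objective, mul_eq_zero, or_iff_right (by norm_num),
    Finset.sum_eq_zero_iff_of_nonneg fun _ _ => sq_nonneg _]
  simp only [Finset.mem_univ, true_imp_iff, sq_eq_zero_iff, sub_eq_zero]
  exact ⟨fun h => funext fun a => (h a).symm, fun h a => by rw [h]⟩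

theorem Feasible.col_dotProduct_self {t : ℕ} {U : Factors n R} (h : Feasible t U) (j : Fin d)
    (i : Fin R) : (U j).col i ⬝ᵥ (U j).col i = 1 := by
  rcases lt_or_ge ((j : ℕ) + t) d with hj | hj
  · exact h.1 j hj i
  · simp [col_dotProduct_col_of_orthonormal (h.2 j hj)]

/-- An exact feasible decomposition has objective zero, so all solutions are exact decompositions;
scalars between unit vectors are signs. -/
theorem IsUniqueDecomposition.isUniqueSolution {t : ℕ} {σ : Fin R → ℝ} {U : Factors n R}
    (huniq : IsUniqueDecomposition σ U) (hU : ∀ j i, (U j).col i ≠ 0) (hfeas : Feasible t U) :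
    IsUniqueSolution t (cpd σ U) σ U := by
  have hzero : objective (cpd σ U) σ U = 0 := objective_eq_zero_iff.2 rfl
  refine ⟨⟨hfeas, fun τ V _ => hzero.le.trans (objective_nonneg _ _ _)⟩, ?_⟩
  rintro τ V ⟨hV, hmin⟩
  have hVA : cpd τ V = cpd σ U := objective_eq_zero_iff.1
    (le_antisymm ((hmin σ U hfeas).trans hzero.le) (objective_nonneg _ _ _))
  obtain ⟨π, hterm, hcol⟩ := huniq τ V hVA
  choose ε _ hε using hcol
  have hsign : ∀ j i, ε j i * ε j i = 1 := by
    intro j i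
    have h := hV.col_dotProduct_self j i
    rwa [hε, smul_dotProduct, dotProduct_smul, hfeas.col_dotProduct_self, smul_eq_mul,
      smul_eq_mul, mul_one] at h
  refine ⟨π, ε, fun j i => mul_self_eq_one_iff.1 (hsign j i), hε, fun i => ?_⟩
  have hne : ∀ j, ∃ a, U j a (π i) ≠ 0 := fun j => Function.ne_iff.1 (hU j (π i))
  choose a ha using hne
  have hprod : outer U (π i) a ≠ 0 := Finset.prod_ne_zero_iff.2 fun j _ => ha j
  have houter : outer V i a = (∏ j, ε j i) * outer U (π i) a := by
    rw [outer, outer, ← Finset.prod_mul_distrib]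
    exact Finset.prod_congr rfl fun j _ => congrFun (hε j i) (a j)
  have h := congrFun (hterm i) a
  rw [Pi.smul_apply, Pi.smul_apply, smul_eq_mul, smul_eq_mul, houter, ← mul_assoc] at h
  have h' := mul_right_cancel₀ hprod h
  have hsq : (∏ j, ε j i) * ∏ j, ε j i = 1 := by
    rw [← Finset.prod_mul_distrib]
    exact Finset.prod_eq_one fun j _ => hsign j i
  rw [← h']
  linear_combination (-τ i) * hsq

end OrthCPD

/-! ### Reduction of the three cases to one Kruskal rank inequality -/

theorem mainTheorem10 (d R t : ℕ) (n : Fin d → ℕ) (A : OrthCPD.Tensor n)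
    (σ : Fin R → ℝ) (U : OrthCPD.Factors n R)
    (ht : 1 ≤ t) (htd : t ≤ d) (hR : 2 ≤ R)
    (hA : A = OrthCPD.cpd σ U)
    (hσ : ∀ i, σ i ≠ 0)
    (hU : ∀ j i, (U j).col i ≠ 0)
    (hOrth : OrthCPD.LastOrthonormal t U)
    (hcases :
      (t = 1 ∧ R + d - 1 ≤
        ∑ j ∈ Finset.univ.filter (fun j : Fin d => (j : ℕ) + 1 < d), OrthCPD.kruskalRank (U j)) ∨
      (t = 2 ∧ ∃ j : Fin d, (j : ℕ) + t < d ∧ 2 ≤ OrthCPD.kruskalRank (U j)) ∨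
      3 ≤ t) :
    OrthCPD.IsUniqueDecomposition σ U ∧
      (OrthCPD.Feasible t U → OrthCPD.IsUniqueSolution t A σ U) := by
  have hd : 1 ≤ d := ht.trans htd
  let m : Fin d := ⟨d - 1, by omega⟩
  have hk : ∀ j, 1 ≤ OrthCPD.kruskalRank (U j) := fun j =>
    OrthCPD.one_le_kruskalRank (U j) (by omega) (hU j)
  have hkR : ∀ j : Fin d, d ≤ (j : ℕ) + t → OrthCPD.kruskalRank (U j) = R := fun j hj =>
    OrthCPD.kruskalRank_eq_of_orthonormal (hOrth j hj)
  -- Two modes besides `m`, one orthonormal and one of Kruskal rank at least two, suffice.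
  have hpair : ∀ p q : Fin d, p ≠ q → p ≠ m → q ≠ m → d ≤ (p : ℕ) + t →
      2 ≤ OrthCPD.kruskalRank (U q) →
      R ≤ ∑ j ∈ Finset.univ.erase m, (OrthCPD.kruskalRank (U j) - 1) := by
    intro p q hpq hp hq hpt hq2
    have hsub : ({p, q} : Finset (Fin d)) ⊆ Finset.univ.erase m := by
      simp [Finset.insert_subset_iff, hp, hq]
    have := Finset.sum_le_sum_of_subset (f := fun j => OrthCPD.kruskalRank (U j) - 1) hsub
    rw [Finset.sum_pair hpq, hkR p hpt] at this
    omega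
  have hsum : R ≤ ∑ j ∈ Finset.univ.erase m, (OrthCPD.kruskalRank (U j) - 1) := by
    rcases hcases with ⟨-, h⟩ | ⟨rfl, j, hj, hj2⟩ | ht3
    · have hfilter : Finset.univ.filter (fun j : Fin d => (j : ℕ) + 1 < d) =
          Finset.univ.erase m := by
        ext j
        simp [m, Fin.ext_iff]
        omega
      have hadd : ∑ j ∈ Finset.univ.erase m, OrthCPD.kruskalRank (U j) =
          ∑ j ∈ Finset.univ.erase m, (OrthCPD.kruskalRank (U j) - 1) + (d - 1) := by
        have hcard : (Finset.univ.erase m).card = d - 1 := by simp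
        rw [← hcard, Finset.card_eq_sum_ones, ← Finset.sum_add_distrib]
        exact Finset.sum_congr rfl fun j _ => (Nat.sub_add_cancel (hk j)).symm
      rw [hfilter, hadd] at h
      omega
    · refine hpair ⟨d - 2, by omega⟩ j ?_ ?_ ?_ ?_ hj2 <;> simp [m, Fin.ext_iff] <;> omega
    · have hq : OrthCPD.kruskalRank (U ⟨d - 3, by omega⟩) = R := hkR _ (by simp; omega)
      refine hpair ⟨d - 2, by omega⟩ ⟨d - 3, by omega⟩ ?_ ?_ ?_ ?_ (by omega) <;>
        simp [m, Fin.ext_iff] <;> omega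
  have huniq := OrthCPD.isUniqueDecomposition_of_orthonormal m hσ hU
    (hOrth m (by simp [m]; omega)) hsum
  exact ⟨huniq, fun hfeas => hA ▸ huniq.isUniqueSolution hU hfeas⟩
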